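/- Let $k$ be a field, $A$ a Frobenius $k$-algebra (a finite-dimensional $k$-algebra with a nondegenerate bilinear form $B$ satisfying $B(ab,c)=B(a,bc)$), $M$ a finite-dimensional left $A$-module, $N$ a simple left $A$-module, and $n>0$ an integer. Then $M$ has a minimal projective resolution $\cdots\to P_1\to P_0\to M\to 0$ and a minimal injective resolution $0\to M\to I^0\to I^1\to\cdots$ by finite-dimensional $A$-modules. (Minimal means that $P_0\to M$ and all $P_{i}\to\ker(P_{i-1}\to P_{i-2})$ are projective covers, respectively that every $I^i$ is an injective hull of the image of the map into it; here and below $P_{-1}=I^{-1}=M$.) For every minimal projective resolution put $\Omega^nM=\ker(P_{n-1}\to P_{n-2})$, and for every minimal injective resolution put $\Omega^{-n}M=\operatorname{coker}(I^{n-2}\to I^{n-1})$, where for $n=1$ these are $\ker(P_0\to M)$ and $\operatorname{coker}(M\to I^0)$. Then there are isomorphisms of $k$-vector spaces $$\operatorname{Ext}^n_A(M,N)\cong\operatorname{Hom}_A(\Omega^nM,N),\qquad \operatorname{Ext}^n_A(N,M)\cong\operatorname{Hom}_A(N,\Omega^{-n}M).$$ Moreover, no passage to the stable category is needed: every $A$-homomorphism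 $\Omega^nM\to N$, and every $A$-homomorphism $N\to\Omega^{-n}M$, that factors through a finite-dimensional projective $A$-module is zero. -/

import Mathlib

open CategoryTheory

universe u v w

/-- A `k`-algebra `A` over a field is a Frobenius algebra if it is finite-dimensional and carries a
nondegenerate bilinear form that is associative: `B (a * b) c = B a (b * c)`. -/
structure IsFrobeniusAlgebra (k : Type*) [Field k] (A : Type*) [Ring A] [Algebra k A] : Prop where
  finiteDimensional : FiniteDimensional k A
  exists_form : ∃ B : LinearMap.BilinForm k A,
    B.Nondegenerate ∧ ∀ a b c : A, B (a * b) c = B a (b * c)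

namespace Heller

section Submodules

variable {A : Type u} [Ring A] {X : Type v} [AddCommGroup X] [Module A X]

/-- `K` is a superfluous (small) submodule of `X`. -/
def IsSuperfluous (K : Submodule A X) : Prop :=
  ∀ L : Submodule A X, K ⊔ L = ⊤ → L = ⊤

/-- `K` is an essential (large) submodule of `X`. -/
def IsEssential (K : Submodule A X) : Prop :=
  ∀ L : Submodule A X, K ⊓ L = ⊥ → L = ⊥

end Submodules

variable {A : Type u} [Ring A] {M : ModuleCat.{v} A}

/-- For a projective resolution `⋯ ⟶ P₁ ⟶ P₀ ⟶ M`, the kernel of the map leaving `Pₙ`: this is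
`ker (P₀ ⟶ M)` for `n = 0` and `ker (Pₙ ⟶ Pₙ₋₁)` for `n > 0`. -/
noncomputable def kerAt (P : ProjectiveResolution M) :
    (n : ℕ) → Submodule A (P.complex.X n)
  | 0 => LinearMap.ker (P.π.f 0).hom
  | n + 1 => LinearMap.ker (P.complex.d (n + 1) n).hom

/-- A minimal projective resolution: every `Pₙ` is a finitely generated module, and
`P₀ ⟶ M` and `Pₙ₊₁ ⟶ kerAt P n` are projective covers, i.e. have superfluous kernel. -/
structure IsMinimalProjective (P : ProjectiveResolution M) : Prop where
  finite : ∀ n, Module.Finite A (P.complex.X n)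
  superfluous : ∀ n, IsSuperfluous (kerAt P n)

/-- The Heller module `Ωⁿ M` computed from `P`: `Ω⁰ M = M` and
`Ωⁿ M = ker (Pₙ₋₁ ⟶ Pₙ₋₂)` for `n > 0`, with `P₋₁ = M`. -/
noncomputable def syzygy (P : ProjectiveResolution M) : ℕ → ModuleCat.{v} A
  | 0 => M
  | n + 1 => ModuleCat.of A (kerAt P n)

/-- For an injective resolution `M ⟶ I⁰ ⟶ I¹ ⟶ ⋯`, the image of the map entering `Iⁿ`: this is
the image of `M` for `n = 0` and the image of `Iⁿ⁻¹` for `n > 0`. -/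
noncomputable def imageAt (I : InjectiveResolution M) :
    (n : ℕ) → Submodule A (I.cocomplex.X n)
  | 0 => LinearMap.range (I.ι.f 0).hom
  | n + 1 => LinearMap.range (I.cocomplex.d n (n + 1)).hom

/-- A minimal injective resolution: every `Iⁿ` is a finitely generated module and an injective hull
of the image of the map entering it, i.e. this image is essential. -/
structure IsMinimalInjective (I : InjectiveResolution M) : Prop where
  finite : ∀ n, Module.Finite A (I.cocomplex.X n)
  essential : ∀ n, IsEssential (imageAt I n)

/-- The Heller module `Ω⁻ⁿ M` computed from `I`: `Ω⁰ M = M` and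
`Ω⁻ⁿ M = coker (Iⁿ⁻² ⟶ Iⁿ⁻¹)` for `n > 0`, with `I⁻¹ = M`. -/
noncomputable def cosyzygy (I : InjectiveResolution M) : ℕ → ModuleCat.{v} A
  | 0 => M
  | n + 1 => ModuleCat.of A (I.cocomplex.X n ⧸ imageAt I n)

/-- `f` factors through a finitely generated projective module, i.e. `f` lies in `PHom`, the ideal
of morphisms that become zero in the stable module category. -/
def FactorsThroughProjective {X Y : ModuleCat.{v} A} (f : X ⟶ Y) : Prop :=
  ∃ (Q : ModuleCat.{v} A) (a : X ⟶ Q) (b : Q ⟶ Y),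
    Module.Finite A Q ∧ Module.Projective A Q ∧ a ≫ b = f

end Heller

/-! A map to a simple module kills superfluous submodules, and a map from a simple module lands in
every essential one (`IsSuperfluous.le_ker`, `IsEssential.range_le`). For a minimal resolution,
every map `Pₙ ⟶ N` therefore vanishes on `Ωⁿ⁺¹ M ⊆ Pₙ`, so all coboundaries of `Hom(P, N)` in
positive degree are zero. Hence `Extⁿ⁺¹(M, N)` is the space of cocycles `Pₙ₊₁ ⟶ N`, which is
`Hom(Ωⁿ⁺¹ M, N)`; the injective case is dual.

A map `Ωⁿ⁺¹ M ⟶ Q ⟶ N` with `Q` finitely generated projective vanishes because `Q` is also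
injective: the first factor extends to `Pₙ`. For `N ⟶ Q ⟶ Ω⁻⁽ⁿ⁺¹⁾ M` it is enough to lift the second
factor to `Iⁿ`.

Minimal resolutions exist because projective covers and injective hulls do. These are minimal
projective or injective submodules of a finite free module, tested by Fitting's lemma. The Frobenius
form makes `A` self-injective and embeds finitely generated modules in free ones. -/

namespace Module.Baer

/-! ### Closure properties of injectivity. -/

variable {A : Type*} [Ring A] {X Y : Type*} [AddCommGroup X] [Module A X] [AddCommGroup Y]
  [Module A Y]

lemma of_retract (h : Module.Baer A X) (i : Y →ₗ[A] X) (r : X →ₗ[A] Y)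
    (hri : r ∘ₗ i = LinearMap.id) : Module.Baer A Y := fun I g ↦ by
  obtain ⟨g', hg'⟩ := h I (i ∘ₗ g)
  refine ⟨r ∘ₗ g', fun x hx ↦ ?_⟩
  simpa [hg' x hx] using LinearMap.congr_fun hri (g ⟨x, hx⟩)

lemma pi {ι : Type*} (h : Module.Baer A X) : Module.Baer A (ι → X) := fun I g ↦ by
  choose g' hg' using fun j ↦ h I (LinearMap.proj j ∘ₗ g)
  exact ⟨LinearMap.pi g', fun x hx ↦ funext fun j ↦ by simpa using hg' j x hx⟩

/-- If `A` is self-injective, then every finitely generated projective module is injective. -/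
lemma of_finite_projective (h : Module.Baer A A) [Module.Finite A X] [Module.Projective A X] :
    Module.Baer A X := by
  obtain ⟨n, f, g, -, -, hfg⟩ := Module.Finite.exists_comp_eq_id_of_projective A X
  exact (h.pi (ι := Fin n)).of_retract g f hfg

end Module.Baer

namespace LinearMap

/-- A consequence of Fitting's lemma: some positive power of an endomorphism
of a module of finite length has a range which is a retract. -/
lemma exists_retraction_range_pow {A X : Type*} [Ring A] [AddCommGroup X] [Module A X]
    [IsArtinian A X] [IsNoetherian A X] (f : Module.End A X) :
    ∃ n : ℕ, ∃ r : X →ₗ[A] LinearMap.range (f ^ (n + 1)),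
      r ∘ₗ (LinearMap.range (f ^ (n + 1))).subtype = LinearMap.id := by
  obtain ⟨n, hn⟩ := Filter.eventually_atTop.mp f.eventually_isCompl_ker_pow_range_pow
  -- The exponent is kept positive so that one factor of `f` can be split off.
  have h := (hn (n + 1) n.le_succ).symm
  exact ⟨n, Submodule.projectionOnto _ _ h, Submodule.projectionOnto_comp_subtype h⟩

end LinearMap

/-! ### Self-injectivity and embeddings into free modules. -/

namespace IsFrobeniusAlgebra

variable {k : Type*} [Field k] {A : Type*} [Ring A] [Algebra k A]

/-- Linear functionals on a module over a Frobenius algebra are induced by linear maps to the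
algebra. -/
lemma exists_linearMap_of_form [FiniteDimensional k A] {B : LinearMap.BilinForm k A}
    (hB : B.Nondegenerate) (hassoc : ∀ a b c : A, B (a * b) c = B a (b * c))
    {X : Type*} [AddCommGroup X] [Module A X] [Module k X] [IsScalarTower k A X]
    (μ : X →ₗ[k] k) : ∃ f : X →ₗ[A] A, ∀ a x, B a (f x) = μ (a • x) := by
  have hinj {x y : A} (h : ∀ a, B a x = B a y) : x = y :=
    sub_eq_zero.mp (hB.2 _ fun a ↦ by simp [h])
  -- `f x` represents the functional `a ↦ μ (a • x)`; associativity of `B` then gives `A`-linearity.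
  have key (x : X) : ∃ c : A, ∀ a, B a c = μ (a • x) :=
    ⟨(B.flip.toDual hB.flip).symm (μ ∘ₗ (LinearMap.toSpanSingleton A X x).restrictScalars k),
      fun a ↦ LinearMap.BilinForm.apply_toDual_symm_apply (hB := hB.flip)
        (μ ∘ₗ (LinearMap.toSpanSingleton A X x).restrictScalars k) a⟩
  choose f hf using key
  refine ⟨{ toFun := f, map_add' := fun x y ↦ hinj fun a ↦ ?_,
            map_smul' := fun b x ↦ hinj fun a ↦ ?_ }, fun a x ↦ hf x a⟩
  · simp [hf]
  · simp only [hf, RingHom.id_apply, smul_eq_mul, ← hassoc, mul_smul]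

/-- A Frobenius algebra is self-injective. -/
lemma baer (hA : IsFrobeniusAlgebra k A) : Module.Baer A A := fun I g ↦ by
  have := hA.finiteDimensional
  obtain ⟨B, hB, hassoc⟩ := hA.exists_form
  -- Only the functional `B 1 ∘ g` is extended, over `k`; it determines `g` because `B a (g x) = B 1
  -- (g (a • x))`.
  obtain ⟨μ, hμ⟩ := LinearMap.exists_extend (p := I.restrictScalars k)
    (B 1 ∘ₗ g.restrictScalars k)
  obtain ⟨f, hf⟩ := exists_linearMap_of_form hB hassoc μ
  refine ⟨f, fun x hx ↦ sub_eq_zero.mp (hB.2 _ fun a ↦ ?_)⟩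
  have h : μ (a • x) = B 1 (g (a • ⟨x, hx⟩)) := LinearMap.congr_fun hμ (a • (⟨x, hx⟩ : I))
  rw [map_sub, hf, h, map_smul, smul_eq_mul, ← hassoc, one_mul, sub_self]

/-- A finitely generated module over a Frobenius algebra embeds in a free module of finite rank. -/
lemma exists_injective_pi (hA : IsFrobeniusAlgebra k A) (X : Type v) [AddCommGroup X] [Module A X]
    [Module.Finite A X] : ∃ (n : ℕ) (f : X →ₗ[A] (Fin n → A)), Function.Injective f := by
  have := hA.finiteDimensional
  obtain ⟨B, hB, hassoc⟩ := hA.exists_form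
  let : Module k X := Module.restrictScalars k A X
  have : IsScalarTower k A X := IsScalarTower.restrictScalars k A X
  have : Module.Finite k X := Module.Finite.trans A X
  let b := Module.finBasis k X
  choose f hf using fun i ↦ exists_linearMap_of_form hB hassoc (b.coord i)
  refine ⟨_, LinearMap.pi f, (injective_iff_map_eq_zero _).mpr fun x hx ↦ ?_⟩
  refine b.forall_coord_eq_zero_iff.mp fun i ↦ ?_
  have := hf i 1 x
  rw [one_smul] at this
  rw [← this, show f i x = 0 from congr_fun hx i, map_zero]

end IsFrobeniusAlgebra

/-! ### Projective covers and injective hulls over Artinian rings. -/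

namespace Heller

section Minimal

variable {A : Type u} [Ring A] [IsArtinianRing A]

/-- Every finitely generated module over an Artinian ring has a projective cover. -/
lemma exists_projectiveCover [Small.{v} A] (M : ModuleCat.{v} A) [Module.Finite A M] :
    ∃ (P : ModuleCat.{v} A) (π : P ⟶ M), Module.Finite A P ∧ Projective P ∧
      Function.Surjective π.hom ∧ IsSuperfluous (LinearMap.ker π.hom) := by
  obtain ⟨m, f, hf⟩ := Module.Finite.exists_fin' A M
  let e : (Fin m → Shrink.{v} A) ≃ₗ[A] (Fin m → A) :=
    LinearEquiv.piCongrRight fun _ ↦ Shrink.linearEquiv A A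
  let F := Fin m → Shrink.{v} A
  have : Module.Finite A F := Module.Finite.equiv e.symm
  have : Module.Projective A F := Module.Projective.of_equiv e.symm
  let p : F →ₗ[A] M := f ∘ₗ e
  have hp : Function.Surjective p := hf.comp e.surjective
  obtain ⟨L, ⟨hL, hLp⟩, hmin⟩ := IsArtinian.set_has_minimal
    {L : Submodule A F | Module.Projective A L ∧ Function.Surjective (p ∘ₗ L.subtype)}
    ⟨⊤, Module.Projective.of_equiv Submodule.topEquiv.symm, fun x ↦
      (hp x).imp' (fun y ↦ ⟨y, trivial⟩) fun _ h ↦ h⟩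
  let π := p ∘ₗ L.subtype
  refine ⟨ModuleCat.of A L, ModuleCat.ofHom π, inferInstance,
    (IsProjective.iff_projective (R := A) L).mp hL, hLp, fun (N : Submodule A L) hN ↦ ?_⟩
  have hNsurj : Function.Surjective (π ∘ₗ N.subtype) := fun x ↦ by
    obtain ⟨y, rfl⟩ := hLp x
    obtain ⟨a, ha, b, hb, rfl⟩ := Submodule.mem_sup.mp (hN ▸ Submodule.mem_top (x := y))
    exact ⟨⟨b, hb⟩, by rw [map_add π, show π a = 0 from ha, zero_add]; rfl⟩
  -- `ψ` has image in `N` and preserves `π`. The range of a suitable power is a projective retract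
  -- of `L` still covering `M`, so minimality makes it all of `L`, whence `N = ⊤`.
  obtain ⟨φ, hφ⟩ := Module.projective_lifting_property (π ∘ₗ N.subtype) π hNsurj
  let ψ : Module.End A L := N.subtype ∘ₗ φ
  have hψ (x : L) : π (ψ x) = π x := LinearMap.congr_fun hφ x
  obtain ⟨n, r, hr⟩ := ψ.exists_retraction_range_pow
  have hψn (x : L) : π ((ψ ^ (n + 1)) x) = π x := by
    induction n + 1 with
    | zero => rfl
    | succ j ih => rw [pow_succ', Module.End.mul_apply, hψ, ih]
  let R := LinearMap.range (ψ ^ (n + 1))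
  have hRN : R ≤ N := by
    rintro _ ⟨x, rfl⟩
    rw [pow_succ', Module.End.mul_apply]
    exact (φ _).2
  have hRL : R.map L.subtype = L := by
    by_contra hne
    refine hmin (R.map L.subtype) ⟨?_, fun x ↦ ?_⟩ (lt_of_le_of_ne (Submodule.map_subtype_le _ _) hne)
    · have : Module.Projective A R := Module.Projective.of_split _ r hr
      exact Module.Projective.of_equiv (Submodule.equivMapOfInjective _ L.injective_subtype R)
    · obtain ⟨y, rfl⟩ := hLp x
      exact ⟨⟨_, (ψ ^ (n + 1)) y, LinearMap.mem_range_self _ y, rfl⟩, hψn y⟩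
  have hR : R = ⊤ := Submodule.map_injective_of_injective L.injective_subtype (by simpa using hRL)
  exact top_unique (hR ▸ hRN)

/-- A module which embeds in a finitely generated injective module over an Artinian ring has a
finitely generated injective hull. -/
lemma exists_injectiveHull {M F : Type v} [AddCommGroup M] [Module A M] [AddCommGroup F]
    [Module A F] [Module.Finite A F] (hF : Module.Baer A F) (f : M →ₗ[A] F)
    (hf : Function.Injective f) :
    ∃ (I : ModuleCat.{v} A) (ι : ModuleCat.of A M ⟶ I), Module.Finite A I ∧ Injective I ∧
      Function.Injective ι.hom ∧ IsEssential (LinearMap.range ι.hom) := by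
  obtain ⟨L, ⟨hL, hLf⟩, hmin⟩ := IsArtinian.set_has_minimal
    {L : Submodule A F | Module.Baer A L ∧ LinearMap.range f ≤ L}
    ⟨⊤, hF.of_equiv Submodule.topEquiv.symm, le_top⟩
  let ι : M →ₗ[A] L := f.codRestrict L fun x ↦ hLf ⟨x, rfl⟩
  have hι : Function.Injective ι := fun x y h ↦ hf (congr_arg Subtype.val h)
  have := hL.injective
  refine ⟨ModuleCat.of A L, ModuleCat.ofHom ι, inferInstance,
    Module.injective_object_of_injective_module A L, hι, fun (N : Submodule A L) hN ↦ ?_⟩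
  have hNinj : Function.Injective (N.mkQ ∘ₗ ι) := by
    refine (injective_iff_map_eq_zero _).mpr fun x hx ↦ (map_eq_zero_iff ι hι).mp ?_
    have : ι x ∈ LinearMap.range ι ⊓ N := ⟨⟨x, rfl⟩, by simpa using hx⟩
    simpa [show LinearMap.range ι ⊓ N = ⊥ from hN] using this
  -- `ψ` kills `N` and fixes the image of `M`. By minimality of `L` some positive power is
  -- surjective, hence injective, so `N = ⊥`.
  obtain ⟨φ, hφ⟩ := hL.extension_property (N.mkQ ∘ₗ ι) hNinj ι
  let ψ : Module.End A L := φ ∘ₗ N.mkQ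
  have hψ (x : M) : ψ (ι x) = ι x := LinearMap.congr_fun hφ x
  obtain ⟨n, r, hr⟩ := ψ.exists_retraction_range_pow
  have hψn (x : M) : (ψ ^ (n + 1)) (ι x) = ι x := by
    induction n + 1 with
    | zero => rfl
    | succ j ih => rw [pow_succ, Module.End.mul_apply, hψ, ih]
  let R := LinearMap.range (ψ ^ (n + 1))
  have hRL : R.map L.subtype = L := by
    by_contra hne
    refine hmin (R.map L.subtype) ⟨?_, ?_⟩ (lt_of_le_of_ne (Submodule.map_subtype_le _ _) hne)
    · exact (hL.of_retract _ r hr).of_equiv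
        (Submodule.equivMapOfInjective _ L.injective_subtype R)
    · rintro _ ⟨x, rfl⟩
      exact ⟨ι x, ⟨ι x, hψn x⟩, rfl⟩
  have hR : R = ⊤ := Submodule.map_injective_of_injective L.injective_subtype (by simpa using hRL)
  have hinj := IsNoetherian.injective_of_surjective_endomorphism _ (LinearMap.range_eq_top.mp hR)
  refine (Submodule.eq_bot_iff _).mpr fun x hx ↦ hinj ?_
  rw [pow_succ, Module.End.mul_apply, map_zero,
    show ψ x = 0 by simp [ψ, (Submodule.Quotient.mk_eq_zero N).mpr hx], map_zero]

end Minimal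

end Heller

/-! ### Splicing covers and hulls into minimal resolutions. -/

namespace Heller

variable {A : Type u} [Ring A]

section Resolutions

variable {M : ModuleCat.{v} A}

/-- The projective resolution given by an exact sequence `⋯ ⟶ K₁ ⟶ K₀ ⟶ M ⟶ 0` of projectives. -/
noncomputable def projectiveResolutionOfExact (K : ChainComplex (ModuleCat.{v} A) ℕ)
    (hK : ∀ n, Projective (K.X n)) (ε : K.X 0 ⟶ M) (hε : Function.Surjective ε.hom)
    (h₀ : LinearMap.range (K.d 1 0).hom = LinearMap.ker ε.hom)
    (h : ∀ n, LinearMap.range (K.d (n + 2) (n + 1)).hom = LinearMap.ker (K.d (n + 1) n).hom) :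
    ProjectiveResolution M where
  complex := K
  projective := hK
  π := (ChainComplex.toSingle₀Equiv _ _).symm
    ⟨ε, ModuleCat.hom_ext (LinearMap.range_le_ker_iff.mp h₀.le)⟩
  quasiIso := ⟨fun n ↦ by
    cases n with
    | zero =>
      rw [ChainComplex.quasiIsoAt₀_iff, ShortComplex.quasiIso_iff_of_zeros']
      · have w : K.d 1 0 ≫ ε = 0 := ModuleCat.hom_ext (LinearMap.range_le_ker_iff.mp h₀.le)
        -- In degree zero, being a quasi-isomorphism means that `K₁ ⟶ K₀ ⟶ M ⟶ 0` is exact.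
        refine (ShortComplex.exact_and_epi_g_iff_of_iso (S₁ := ShortComplex.mk _ _ w) ?_).1
          ⟨(ShortComplex.moduleCat_exact_iff_range_eq_ker _).mpr h₀,
            (ModuleCat.epi_iff_surjective _).mpr hε⟩
        exact ShortComplex.isoMk (Iso.refl _) (Iso.refl _) (Iso.refl _)
          ((Category.id_comp _).trans (Category.comp_id _).symm)
          ((Category.id_comp _).trans (Category.comp_id _).symm)
      all_goals first | rfl | exact K.shape _ _ (by simp)
    | succ n =>
      rw [quasiIsoAt_iff_exactAt' _ _ (ChainComplex.exactAt_succ_single_obj _ _),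
        HomologicalComplex.exactAt_iff' _ (n + 2) (n + 1) n (by simp) (by simp),
        ShortComplex.moduleCat_exact_iff_range_eq_ker]
      exact h n⟩

/-- The injective resolution given by an exact sequence `0 ⟶ M ⟶ K⁰ ⟶ K¹ ⟶ ⋯` of injectives. -/
noncomputable def injectiveResolutionOfExact (K : CochainComplex (ModuleCat.{v} A) ℕ)
    (hK : ∀ n, Injective (K.X n)) (ε : M ⟶ K.X 0) (hε : Function.Injective ε.hom)
    (h₀ : LinearMap.range ε.hom = LinearMap.ker (K.d 0 1).hom)
    (h : ∀ n, LinearMap.range (K.d n (n + 1)).hom = LinearMap.ker (K.d (n + 1) (n + 2)).hom) :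
    InjectiveResolution M where
  cocomplex := K
  injective := hK
  ι := (CochainComplex.fromSingle₀Equiv _ _).symm
    ⟨ε, ModuleCat.hom_ext (LinearMap.range_le_ker_iff.mp h₀.le)⟩
  quasiIso := ⟨fun n ↦ by
    cases n with
    | zero =>
      rw [CochainComplex.quasiIsoAt₀_iff, ShortComplex.quasiIso_iff_of_zeros]
      · have w : ε ≫ K.d 0 1 = 0 := ModuleCat.hom_ext (LinearMap.range_le_ker_iff.mp h₀.le)
        refine (ShortComplex.exact_and_mono_f_iff_of_iso (S₁ := ShortComplex.mk _ _ w) ?_).1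
          ⟨(ShortComplex.moduleCat_exact_iff_range_eq_ker _).mpr h₀,
            (ModuleCat.mono_iff_injective _).mpr hε⟩
        exact ShortComplex.isoMk (Iso.refl _) (Iso.refl _) (Iso.refl _)
          ((Category.id_comp _).trans (Category.comp_id _).symm)
          ((Category.id_comp _).trans (Category.comp_id _).symm)
      all_goals first | rfl | exact K.shape _ _ (by simp)
    | succ n =>
      rw [quasiIsoAt_iff_exactAt _ _ (CochainComplex.exactAt_succ_single_obj _ _),
        HomologicalComplex.exactAt_iff' _ n (n + 1) (n + 2) (by simp) (by simp),
        ShortComplex.moduleCat_exact_iff_range_eq_ker]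
      exact h n⟩

end Resolutions

/-- The iterates of an operation on finitely generated modules. -/
noncomputable def iterateModule (T : ∀ M : ModuleCat.{v} A, Module.Finite A M → ModuleCat.{v} A)
    (hT : ∀ M hM, Module.Finite A (T M hM)) (M : ModuleCat.{v} A) (hM : Module.Finite A M) :
    ℕ → {M : ModuleCat.{v} A // Module.Finite A M}
  | 0 => ⟨M, hM⟩
  | n + 1 => ⟨T _ (iterateModule T hT M hM n).2, hT _ _⟩

/-- Iterated projective covers form a minimal projective resolution. -/
theorem exists_isMinimalProjective [IsArtinianRing A] [Small.{v} A] (M : ModuleCat.{v} A)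
    [hM : Module.Finite A M] : ∃ P : ProjectiveResolution M, IsMinimalProjective P := by
  choose P π hfin hproj hsurj hsup using
    fun (M : ModuleCat.{v} A) (_ : Module.Finite A M) ↦ exists_projectiveCover M
  have hT (M) (hM) : Module.Finite A (ModuleCat.of A (LinearMap.ker (π M hM).hom)) := by
    have := hfin M hM
    infer_instance
  let S := iterateModule (fun M hM ↦ ModuleCat.of A (LinearMap.ker (π M hM).hom)) hT M hM
  let X (n : ℕ) : ModuleCat.{v} A := P (S n).1 (S n).2
  let p (n : ℕ) : X n ⟶ (S n).1 := π (S n).1 (S n).2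
  let i (n : ℕ) : (S (n + 1)).1 ⟶ X n := ModuleCat.ofHom (LinearMap.ker (p n).hom).subtype
  let d (n : ℕ) : X (n + 1) ⟶ X n := p (n + 1) ≫ i n
  have hi (n) : Function.Injective (i n).hom := Subtype.val_injective
  have hker (n) : LinearMap.ker (d n).hom = LinearMap.ker (p (n + 1)).hom :=
    LinearMap.ker_comp_of_ker_eq_bot _ (LinearMap.ker_eq_bot.mpr (hi n))
  have hrange (n) : LinearMap.range (d n).hom = LinearMap.ker (p n).hom :=
    (LinearMap.range_comp_of_range_eq_top _ (LinearMap.range_eq_top.mpr (hsurj _ _))).trans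
      (Submodule.range_subtype _)
  let K : ChainComplex (ModuleCat.{v} A) ℕ := ChainComplex.of X d fun n ↦
    ModuleCat.hom_ext (LinearMap.range_le_ker_iff.mp ((hrange _).trans (hker n).symm).le)
  have hd (n) : K.d (n + 1) n = d n := ChainComplex.of_d ..
  have hkerK (n) : LinearMap.ker (K.d (n + 1) n).hom = LinearMap.ker (p (n + 1)).hom :=
    (congr_arg (fun f : X (n + 1) ⟶ X n ↦ LinearMap.ker f.hom) (hd n)).trans (hker n)
  have hrangeK (n) : LinearMap.range (K.d (n + 1) n).hom = LinearMap.ker (p n).hom :=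
    (congr_arg (fun f : X (n + 1) ⟶ X n ↦ LinearMap.range f.hom) (hd n)).trans (hrange n)
  let R : ProjectiveResolution M := projectiveResolutionOfExact K (fun n ↦ hproj _ _) (p 0)
    (hsurj _ _) (hrangeK 0) fun n ↦ (hrangeK _).trans (hkerK n).symm
  refine ⟨R, fun n ↦ hfin _ _, fun n ↦ ?_⟩
  cases n with
  | zero =>
    have h : R.π.f 0 = p 0 := ChainComplex.toSingle₀Equiv_symm_apply_f_zero (C := K) _ _
    exact (congr_arg (fun f : X 0 ⟶ M ↦ IsSuperfluous (LinearMap.ker f.hom)) h).mpr (hsup _ _)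
  | succ n => exact (congr_arg IsSuperfluous (hkerK n)).mpr (hsup _ _)

/-- Iterated injective hulls form a minimal injective resolution, provided that every finitely
generated module embeds in a finitely generated injective module. -/
theorem exists_isMinimalInjective [IsArtinianRing A] (M : ModuleCat.{v} A)
    [hM : Module.Finite A M]
    (hull : ∀ M : ModuleCat.{v} A, Module.Finite A M → ∃ (I : ModuleCat.{v} A) (ι : M ⟶ I),
      Module.Finite A I ∧ Injective I ∧ Function.Injective ι.hom ∧
        IsEssential (LinearMap.range ι.hom)) :
    ∃ I : InjectiveResolution M, IsMinimalInjective I := by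
  choose I ι hfin hinj hι hess using hull
  have hT (M) (hM) : Module.Finite A (ModuleCat.of A (I M hM ⧸ LinearMap.range (ι M hM).hom)) := by
    have := hfin M hM
    infer_instance
  let S := iterateModule (fun M hM ↦ ModuleCat.of A (I M hM ⧸ LinearMap.range (ι M hM).hom)) hT M hM
  let X (n : ℕ) : ModuleCat.{v} A := I (S n).1 (S n).2
  let i (n : ℕ) : (S n).1 ⟶ X n := ι (S n).1 (S n).2
  let q (n : ℕ) : X n ⟶ (S (n + 1)).1 := ModuleCat.ofHom (LinearMap.range (i n).hom).mkQ
  let d (n : ℕ) : X n ⟶ X (n + 1) := q n ≫ i (n + 1)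
  have hq (n) : Function.Surjective (q n).hom := Submodule.mkQ_surjective _
  have hker (n) : LinearMap.ker (d n).hom = LinearMap.range (i n).hom :=
    (LinearMap.ker_comp_of_ker_eq_bot _ (LinearMap.ker_eq_bot.mpr (hι _ _))).trans
      (Submodule.ker_mkQ _)
  have hrange (n) : LinearMap.range (d n).hom = LinearMap.range (i (n + 1)).hom :=
    LinearMap.range_comp_of_range_eq_top _ (LinearMap.range_eq_top.mpr (hq n))
  let K : CochainComplex (ModuleCat.{v} A) ℕ := CochainComplex.of X d fun n ↦
    ModuleCat.hom_ext (LinearMap.range_le_ker_iff.mp ((hrange n).trans (hker _).symm).le)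
  have hd (n) : K.d n (n + 1) = d n := CochainComplex.of_d ..
  have hkerK (n) : LinearMap.ker (K.d n (n + 1)).hom = LinearMap.range (i n).hom :=
    (congr_arg (fun f : X n ⟶ X (n + 1) ↦ LinearMap.ker f.hom) (hd n)).trans (hker n)
  have hrangeK (n) : LinearMap.range (K.d n (n + 1)).hom = LinearMap.range (i (n + 1)).hom :=
    (congr_arg (fun f : X n ⟶ X (n + 1) ↦ LinearMap.range f.hom) (hd n)).trans (hrange n)
  let R : InjectiveResolution M := injectiveResolutionOfExact K (fun n ↦ hinj _ _) (i 0)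
    (hι _ _) (hkerK 0).symm fun n ↦ (hrangeK n).trans (hkerK _).symm
  refine ⟨R, fun n ↦ hfin _ _, fun n ↦ ?_⟩
  cases n with
  | zero =>
    have h : R.ι.f 0 = i 0 := CochainComplex.fromSingle₀Equiv_symm_apply_f_zero (C := K) _ _
    exact (congr_arg (fun f : M ⟶ X 0 ↦ IsEssential (LinearMap.range f.hom)) h).mpr (hess _ _)
  | succ n => exact (congr_arg IsEssential (hrangeK n)).mpr (hess _ _)

end Heller

/-! ### Heller modules, simple modules and Ext. -/

namespace Heller

section Simple

variable {A : Type u} [Ring A] {X : Type*} {N : Type v} [AddCommGroup X] [Module A X]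
  [AddCommGroup N] [Module A N] [IsSimpleModule A N]

/-- A linear map to a simple module vanishes on every superfluous submodule. -/
lemma IsSuperfluous.le_ker {K : Submodule A X} (hK : IsSuperfluous K) (g : X →ₗ[A] N) :
    K ≤ LinearMap.ker g := by
  rcases eq_bot_or_eq_top (K.map g) with h | h
  · exact (Submodule.map_le_iff_le_comap (p := K) (f := g)).mp h.le
  -- If `K` maps onto `N`, then `K` and `ker g` together span `X`, so `ker g = ⊤`.
  · refine le_top.trans (hK _ (eq_top_iff.mpr fun x _ ↦ ?_)).ge
    obtain ⟨y, hy, hxy⟩ : g x ∈ K.map g := h ▸ Submodule.mem_top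
    exact Submodule.mem_sup.mpr ⟨y, hy, x - y, by simp [hxy], by simp⟩

/-- The range of a linear map from a simple module is contained in every essential submodule. -/
lemma IsEssential.range_le {K : Submodule A X} (hK : IsEssential K) (g : N →ₗ[A] X) :
    LinearMap.range g ≤ K := by
  rcases eq_bot_or_eq_top (K.comap g) with h | h
  · refine (hK _ (eq_bot_iff.mpr ?_)).le.trans bot_le
    rintro _ ⟨hx, y, rfl⟩
    have : y ∈ K.comap g := hx
    rw [h, Submodule.mem_bot] at this
    simp [this]
  · rintro _ ⟨x, rfl⟩
    exact Submodule.mem_comap.mp (h ▸ Submodule.mem_top)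

end Simple

variable {A : Type u} [Ring A] {M : ModuleCat.{v} A}

section Projective

variable (P : ProjectiveResolution M)

lemma range_d_eq_kerAt (n : ℕ) :
    LinearMap.range (P.complex.d (n + 1) n).hom = kerAt P n := by
  cases n with
  | zero => exact P.exact₀.moduleCat_range_eq_ker
  | succ n => exact (P.exact_succ n).moduleCat_range_eq_ker

/-- The surjection `Pₙ₊₁ ⟶ Ωⁿ⁺¹ M`. -/
noncomputable def toSyzygy (n : ℕ) : P.complex.X (n + 1) ⟶ syzygy P (n + 1) :=
  ModuleCat.ofHom ((P.complex.d (n + 1) n).hom.codRestrict (kerAt P n) fun x ↦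
    (range_d_eq_kerAt P n).le ⟨x, rfl⟩)

/-- The inclusion `Ωⁿ⁺¹ M ⟶ Pₙ`. -/
noncomputable def syzygyι (n : ℕ) : syzygy P (n + 1) ⟶ P.complex.X n :=
  ModuleCat.ofHom (kerAt P n).subtype

lemma toSyzygy_comp_syzygyι (n : ℕ) :
    toSyzygy P n ≫ syzygyι P n = P.complex.d (n + 1) n := rfl

lemma toSyzygy_surjective (n : ℕ) : Function.Surjective (toSyzygy P n).hom := by
  rintro ⟨x, hx⟩
  obtain ⟨y, rfl⟩ := (range_d_eq_kerAt P n).ge hx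
  exact ⟨y, rfl⟩

instance (n : ℕ) : Epi (toSyzygy P n) :=
  (ModuleCat.epi_iff_surjective _).mpr (toSyzygy_surjective P n)

lemma d_comp_toSyzygy (n : ℕ) : P.complex.d (n + 2) (n + 1) ≫ toSyzygy P n = 0 := by
  ext x
  exact Subtype.ext (congr($(P.complex.d_comp_d (n + 2) (n + 1) n).hom x))

/-- A morphism on `Pₙ₊₁` which vanishes on boundaries descends to the Heller module. -/
lemma exists_toSyzygy_comp_eq {N : ModuleCat.{v} A} (n : ℕ) (f : P.complex.X (n + 1) ⟶ N)
    (hf : P.complex.d (n + 2) (n + 1) ≫ f = 0) : ∃ g, toSyzygy P n ≫ g = f := by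
  have hker : LinearMap.ker (toSyzygy P n).hom ≤ LinearMap.ker f.hom := by
    intro x hx
    have hx' : x ∈ kerAt P (n + 1) := congr_arg Subtype.val hx
    obtain ⟨y, rfl⟩ := (range_d_eq_kerAt P (n + 1)).ge hx'
    exact congr($(hf).hom y)
  let t := (toSyzygy P n).hom
  let e := t.quotKerEquivOfSurjective (toSyzygy_surjective P n)
  refine ⟨ModuleCat.ofHom ((LinearMap.ker t).liftQ f.hom hker ∘ₗ e.symm.toLinearMap), ?_⟩
  ext x
  exact congr_arg ((LinearMap.ker t).liftQ f.hom hker)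
    (e.symm_apply_apply (Submodule.Quotient.mk x))

variable {N : ModuleCat.{v} A} [IsSimpleModule A N] {P}

lemma IsMinimalProjective.syzygyι_comp_eq_zero (hP : IsMinimalProjective P) (n : ℕ)
    (g : P.complex.X n ⟶ N) : syzygyι P n ≫ g = 0 := by
  ext x
  exact (hP.superfluous n).le_ker g.hom x.2

/-- Self-injectivity of `A` makes `Q` injective, so `a` extends along `Ωⁿ⁺¹ M ⊆ Pₙ`, and minimality
kills the restriction of any map `Pₙ ⟶ N`. -/
theorem IsMinimalProjective.eq_zero_of_factorsThroughProjective (hP : IsMinimalProjective P)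
    (hA : Module.Baer A A) (n : ℕ) (f : syzygy P (n + 1) ⟶ N) (hf : FactorsThroughProjective f) :
    f = 0 := by
  obtain ⟨Q, a, b, _, _, rfl⟩ := hf
  obtain ⟨c, hc⟩ := (Module.Baer.of_finite_projective (X := Q) hA).extension_property
    (kerAt P n).subtype (kerAt P n).injective_subtype a.hom
  have hc' : syzygyι P n ≫ ModuleCat.ofHom c = a := ModuleCat.hom_ext hc
  rw [← hc', Category.assoc]
  exact hP.syzygyι_comp_eq_zero n _

variable (k : Type w) [Field k] [Algebra k A] [Small.{v} A]

/-- The linear map `Hom(Ωⁿ M, N) → Extⁿ(M, N)`. -/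
noncomputable def syzygyHomToExt (P : ProjectiveResolution M) (N : ModuleCat.{v} A) (n : ℕ) :
    (syzygy P (n + 1) ⟶ N) →ₗ[k] Abelian.Ext M N (n + 1) :=
  Abelian.Ext.precompOfLinear (P.extMk (toSyzygy P n) (n + 2) rfl (d_comp_toSyzygy P n))
    k N (add_zero _) ∘ₗ Abelian.Ext.linearEquiv₀.symm.toLinearMap

/-- Describes the Ext class by an explicit cocycle, which reduces bijectivity to cocycles and
coboundaries. -/
lemma syzygyHomToExt_apply (P : ProjectiveResolution M) (N : ModuleCat.{v} A) (n : ℕ)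
    (f : syzygy P (n + 1) ⟶ N) :
    syzygyHomToExt k P N n f = P.extMk (toSyzygy P n ≫ f) (n + 2) rfl
      (by rw [← Category.assoc, d_comp_toSyzygy, Limits.zero_comp]) :=
  P.extMk_comp_mk₀ _ _ _ _ _

lemma syzygyHomToExt_surjective (P : ProjectiveResolution M) (N : ModuleCat.{v} A) (n : ℕ) :
    Function.Surjective (syzygyHomToExt k P N n) := fun α ↦ by
  obtain ⟨f, hf, rfl⟩ := P.extMk_surjective α (n + 2) rfl
  obtain ⟨g, rfl⟩ := exists_toSyzygy_comp_eq P n f hf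
  exact ⟨g, syzygyHomToExt_apply k P N n g⟩

lemma IsMinimalProjective.syzygyHomToExt_injective (hP : IsMinimalProjective P) (n : ℕ) :
    Function.Injective (syzygyHomToExt k P N n) := by
  refine (injective_iff_map_eq_zero _).mpr fun f hf ↦ ?_
  rw [syzygyHomToExt_apply, P.extMk_eq_zero_iff _ _ _ _ n rfl] at hf
  obtain ⟨g, hg⟩ := hf
  rw [← toSyzygy_comp_syzygyι, Category.assoc, cancel_epi, hP.syzygyι_comp_eq_zero] at hg
  -- The cocycle of `f` is a coboundary `d ≫ g`, which is zero by minimality; `toSyzygy` is epi and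
  -- has been cancelled.
  exact hg.symm

end Projective

section Injective

variable (I : InjectiveResolution M)

lemma imageAt_eq_ker_d (n : ℕ) :
    imageAt I n = LinearMap.ker (I.cocomplex.d n (n + 1)).hom := by
  cases n with
  | zero => exact (ShortComplex.exact_of_f_is_kernel
      (ShortComplex.mk _ _ I.ι_f_zero_comp_complex_d) I.isLimitKernelFork).moduleCat_range_eq_ker
  | succ n => exact (I.exact_succ n).moduleCat_range_eq_ker

/-- The injection `Ω⁻⁽ⁿ⁺¹⁾ M ⟶ Iⁿ⁺¹`. -/
noncomputable def fromCosyzygy (n : ℕ) : cosyzygy I (n + 1) ⟶ I.cocomplex.X (n + 1) :=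
  ModuleCat.ofHom ((imageAt I n).liftQ (I.cocomplex.d n (n + 1)).hom (imageAt_eq_ker_d I n).le)

/-- The projection `Iⁿ ⟶ Ω⁻⁽ⁿ⁺¹⁾ M`. -/
noncomputable def cosyzygyπ (n : ℕ) : I.cocomplex.X n ⟶ cosyzygy I (n + 1) :=
  ModuleCat.ofHom (imageAt I n).mkQ

lemma cosyzygyπ_comp_fromCosyzygy (n : ℕ) :
    cosyzygyπ I n ≫ fromCosyzygy I n = I.cocomplex.d n (n + 1) := rfl

lemma cosyzygyπ_surjective (n : ℕ) : Function.Surjective (cosyzygyπ I n).hom :=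
  Submodule.mkQ_surjective _

instance (n : ℕ) : Epi (cosyzygyπ I n) :=
  (ModuleCat.epi_iff_surjective _).mpr (cosyzygyπ_surjective I n)

lemma fromCosyzygy_injective (n : ℕ) : Function.Injective (fromCosyzygy I n).hom :=
  LinearMap.ker_eq_bot.mp (Submodule.ker_liftQ_eq_bot' _ _ (imageAt_eq_ker_d I n))

instance (n : ℕ) : Mono (fromCosyzygy I n) :=
  (ModuleCat.mono_iff_injective _).mpr (fromCosyzygy_injective I n)

lemma range_fromCosyzygy (n : ℕ) :
    LinearMap.range (fromCosyzygy I n).hom = imageAt I (n + 1) :=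
  Submodule.range_liftQ _ _ _

lemma fromCosyzygy_comp_d (n : ℕ) :
    fromCosyzygy I n ≫ I.cocomplex.d (n + 1) (n + 2) = 0 := by
  rw [← cancel_epi (cosyzygyπ I n), ← Category.assoc, cosyzygyπ_comp_fromCosyzygy,
    I.cocomplex.d_comp_d, Limits.comp_zero]

/-- A morphism to the cocycles of `Iⁿ⁺¹` lifts to the Heller module. -/
lemma exists_comp_fromCosyzygy_eq {N : ModuleCat.{v} A} (n : ℕ) (f : N ⟶ I.cocomplex.X (n + 1))
    (hf : f ≫ I.cocomplex.d (n + 1) (n + 2) = 0) : ∃ g, g ≫ fromCosyzygy I n = f := by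
  have hmem (x : N) : f.hom x ∈ LinearMap.range (fromCosyzygy I n).hom := by
    rw [range_fromCosyzygy, imageAt_eq_ker_d]
    exact congr($(hf).hom x)
  let e := LinearEquiv.ofInjective _ (fromCosyzygy_injective I n)
  refine ⟨ModuleCat.ofHom (e.symm.toLinearMap ∘ₗ f.hom.codRestrict _ hmem), ?_⟩
  ext x
  exact congr_arg Subtype.val (e.apply_symm_apply ⟨f.hom x, hmem x⟩)

variable {N : ModuleCat.{v} A} [IsSimpleModule A N] {I}

lemma IsMinimalInjective.comp_cosyzygyπ_eq_zero (hI : IsMinimalInjective I) (n : ℕ)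
    (g : N ⟶ I.cocomplex.X n) : g ≫ cosyzygyπ I n = 0 := by
  ext x
  exact (Submodule.Quotient.mk_eq_zero _).mpr ((hI.essential n).range_le g.hom ⟨x, rfl⟩)

/-- Projectivity of `Q` lifts `b` to `Iⁿ`; the resulting map `N ⟶ Iⁿ` lands in the essential image,
which the quotient kills. -/
theorem IsMinimalInjective.eq_zero_of_factorsThroughProjective (hI : IsMinimalInjective I)
    (n : ℕ) (f : N ⟶ cosyzygy I (n + 1)) (hf : FactorsThroughProjective f) : f = 0 := by
  obtain ⟨Q, a, b, _, _, rfl⟩ := hf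
  rw [← Projective.factorThru_comp b (cosyzygyπ I n), ← Category.assoc]
  exact hI.comp_cosyzygyπ_eq_zero n _

variable (k : Type w) [Field k] [Algebra k A] [Small.{v} A]

/-- The linear map `Hom(N, Ω⁻ⁿ M) → Extⁿ(N, M)`. -/
noncomputable def homCosyzygyToExt (I : InjectiveResolution M) (N : ModuleCat.{v} A) (n : ℕ) :
    (N ⟶ cosyzygy I (n + 1)) →ₗ[k] Abelian.Ext N M (n + 1) :=
  Abelian.Ext.postcompOfLinear (I.extMk (fromCosyzygy I n) (n + 2) rfl (fromCosyzygy_comp_d I n))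
    k N (zero_add _) ∘ₗ Abelian.Ext.linearEquiv₀.symm.toLinearMap

lemma homCosyzygyToExt_apply (I : InjectiveResolution M) (N : ModuleCat.{v} A) (n : ℕ)
    (f : N ⟶ cosyzygy I (n + 1)) :
    homCosyzygyToExt k I N n f = I.extMk (f ≫ fromCosyzygy I n) (n + 2) rfl
      (by rw [Category.assoc, fromCosyzygy_comp_d, Limits.comp_zero]) :=
  I.mk₀_comp_extMk _ _ _ _ _

lemma homCosyzygyToExt_surjective (I : InjectiveResolution M) (N : ModuleCat.{v} A) (n : ℕ) :
    Function.Surjective (homCosyzygyToExt k I N n) := fun α ↦ by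
  obtain ⟨f, hf, rfl⟩ := I.extMk_surjective α (n + 2) rfl
  obtain ⟨g, rfl⟩ := exists_comp_fromCosyzygy_eq I n f hf
  exact ⟨g, homCosyzygyToExt_apply k I N n g⟩

lemma IsMinimalInjective.homCosyzygyToExt_injective (hI : IsMinimalInjective I) (n : ℕ) :
    Function.Injective (homCosyzygyToExt k I N n) := by
  refine (injective_iff_map_eq_zero _).mpr fun f hf ↦ ?_
  rw [homCosyzygyToExt_apply, I.extMk_eq_zero_iff _ _ _ _ n rfl] at hf
  obtain ⟨g, hg⟩ := hf
  rw [← cosyzygyπ_comp_fromCosyzygy, ← Category.assoc, cancel_mono,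
    hI.comp_cosyzygyπ_eq_zero] at hg
  exact hg.symm

end Injective

end Heller

theorem proposition7 {k : Type w} [Field k] {A : Type u} [Ring A] [Algebra k A] [Small.{v} A]
    (hA : IsFrobeniusAlgebra k A) (M N : ModuleCat.{v} A) [Module.Finite A M] [IsSimpleModule A N]
    (n : ℕ) (hn : 0 < n) :
    (∃ P : ProjectiveResolution M, Heller.IsMinimalProjective P) ∧
    (∃ I : InjectiveResolution M, Heller.IsMinimalInjective I) ∧
    (∀ P : ProjectiveResolution M, Heller.IsMinimalProjective P →
      (∀ f : Heller.syzygy P n ⟶ N, Heller.FactorsThroughProjective f → f = 0) ∧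
      Nonempty (Abelian.Ext M N n ≃ₗ[k] (Heller.syzygy P n ⟶ N))) ∧
    (∀ I : InjectiveResolution M, Heller.IsMinimalInjective I →
      (∀ f : N ⟶ Heller.cosyzygy I n, Heller.FactorsThroughProjective f → f = 0) ∧
      Nonempty (Abelian.Ext N M n ≃ₗ[k] (N ⟶ Heller.cosyzygy I n))) := by
  have := hA.finiteDimensional
  have : IsArtinianRing A := IsArtinianRing.of_finite k A
  obtain ⟨n, rfl⟩ := Nat.exists_eq_add_one.mpr hn
  refine ⟨Heller.exists_isMinimalProjective M,
    Heller.exists_isMinimalInjective M fun X _ ↦ ?_, fun P hP ↦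
    ⟨hP.eq_zero_of_factorsThroughProjective hA.baer n, ⟨(LinearEquiv.ofBijective _
      ⟨hP.syzygyHomToExt_injective k n, Heller.syzygyHomToExt_surjective k P N n⟩).symm⟩⟩,
    fun I hI ↦ ⟨hI.eq_zero_of_factorsThroughProjective n, ⟨(LinearEquiv.ofBijective _
      ⟨hI.homCosyzygyToExt_injective k n, Heller.homCosyzygyToExt_surjective k I N n⟩).symm⟩⟩⟩
  -- The remaining goal is an injective hull of `X`. It is found inside a finite free module,
  -- injective by self-injectivity; `Shrink` places that module in universe `v`.
  obtain ⟨m, f, hf⟩ := hA.exists_injective_pi X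
  let e : (Fin m → Shrink.{v} A) ≃ₗ[A] (Fin m → A) :=
    LinearEquiv.piCongrRight fun _ ↦ Shrink.linearEquiv A A
  have : Module.Finite A (Fin m → Shrink.{v} A) := Module.Finite.equiv e.symm
  exact Heller.exists_injectiveHull (hA.baer.pi.of_equiv e.symm) (e.symm.toLinearMap ∘ₗ f)
    (e.symm.injective.comp hf)
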